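/- All graphs are undirected, without loops and multiple edges, and possibly infinite unless said otherwise; $V(\Gamma)$ and $E(\Gamma)$ denote the sets of vertices and edges of a graph $\Gamma$. For graphs $K$ and $\Gamma$, the *edge representativeness* $\Upsilon_e(K,\Gamma)$ is the smallest cardinality of a set of edges $X\subseteq E(\Gamma)$ such that every (not necessarily induced) subgraph of $\Gamma$ isomorphic to $K$ contains an edge from $X$, and the *symmetric edge representativeness* $\Upsilon_e^{\mathrm{sym}}(K,\Gamma)$ is the smallest cardinality of such a set $X$ that is moreover invariant under all automorphisms of $\Gamma$; each of these values is $\infty$ if no finite set of the required kind exists. A finite graph $K$ is called *edge-costly* if for every $m\in\mathbb{Z}$ there is a graph $\Gamma_m$ for which $\Upsilon_e(K,\Gamma_m)$ and $\Upsilon_e^{\mathrm{sym}}(K,\Gamma_m)$ are finite and $$\Upsilon_e^{\mathrm{sym}}(K,\Gamma_m)=\Upsilon_e(K,\Gamma_m)\cdot|E(K)|\ge m .$$ **Theorem.** Let $K$ be a finite connected graph with exactly one vertex of degree one, and suppose that the graph obtained from $K$ by deleting this vertex and the edge incident to it is vertex-transitive (i.e. its automorphism group acts transitively on its vertices). Then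 $$\Upsilon_e^{\mathrm{sym}}(K,\Gamma)\le(|E(K)|-1)\cdot\Upsilon_e(K,\Gamma)$$ for every graph $\Gamma$. In particular, $K$ is not edge-costly. -/

import Mathlib

universe u v

namespace SimpleGraph

variable {V : Type u} {W : Type v}

/-- A graph is vertex-transitive if its automorphism group acts transitively on its vertices. -/
def IsVertexTransitive (G : SimpleGraph V) : Prop :=
  ∀ x y : V, ∃ φ : G ≃g G, φ x = y

/-- `X` is a set of edges of `Γ` such that every (not necessarily induced) subgraph of `Γ`
isomorphic to `K` contains an edge from `X`. -/
def IsEdgeRepresentative (K : SimpleGraph W) (Γ : SimpleGraph V) (X : Set (Sym2 V)) : Prop :=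
  X ⊆ Γ.edgeSet ∧
    ∀ H : Γ.Subgraph, Nonempty (K ≃g H.coe) → ∃ e ∈ H.edgeSet, e ∈ X

/-- A set `X` of unordered pairs of vertices of `Γ` is invariant under all automorphisms
of `Γ`. -/
def IsAutInvariant (Γ : SimpleGraph V) (X : Set (Sym2 V)) : Prop :=
  ∀ φ : Γ ≃g Γ, Sym2.map φ '' X = X

/-- The edge representativeness of `K` in `Γ`: the smallest cardinality of a set of edges of `Γ`
meeting every subgraph isomorphic to `K`, with value `⊤` if there is no such finite set. -/
noncomputable def edgeRep (K : SimpleGraph W) (Γ : SimpleGraph V) : ℕ∞ :=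
  sInf {n : ℕ∞ | ∃ X : Set (Sym2 V), IsEdgeRepresentative K Γ X ∧ X.encard = n}

/-- The symmetric edge representativeness of `K` in `Γ`: the smallest cardinality of an
`Aut Γ`-invariant set of edges of `Γ` meeting every subgraph isomorphic to `K`, with value `⊤` if
there is no such finite set. -/
noncomputable def symEdgeRep (K : SimpleGraph W) (Γ : SimpleGraph V) : ℕ∞ :=
  sInf {n : ℕ∞ | ∃ X : Set (Sym2 V),
    IsEdgeRepresentative K Γ X ∧ IsAutInvariant Γ X ∧ X.encard = n}

/-- A graph `K` is edge-costly if for every integer `m` there is a graph `Γ` such that the two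
representativenesses of `K` in `Γ` are integers (i.e. finite), the symmetric one is the other one
times the number of edges of `K`, and this number is at least `m`. The graphs `Γ` range over all,
possibly infinite, graphs with vertices in the universe `u`. -/
def IsEdgeCostly (K : SimpleGraph W) : Prop :=
  ∀ m : ℤ, ∃ (V : Type u) (Γ : SimpleGraph V) (n s : ℕ),
    edgeRep K Γ = n ∧ symEdgeRep K Γ = s ∧ s = n * K.edgeSet.ncard ∧ m ≤ (s : ℤ)

end SimpleGraph

/-!
Let `M` be `K` without its pendant vertex, and let `X` be a finite set of edges meeting every copy
of `K`. Averaging `X` over `Aut Γ` gives an invariant weighting `w` of the edges of total at most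
`|X|`, the density of `X` in each orbit; orbits may be infinite, and B. H. Neumann's lemma
shows that these can be ignored.

As `M` is vertex-transitive, a copy of `M` that avoids `X` has all its boundary edges in `X`. Hence
the edges of a copy of `M` and any one of its boundary edges have total weight at least `1`.
Moreover `M` is bridgeless, so that a copy of `M` crossing the boundary of another one crosses it
at least twice; hence two copies of `M` on distinct intersecting vertex sets have total weight at
least `2`.

The heavy edges, those of weight at least `θ = 1 / |E(M)|`, meet every copy of `K` except near some
copies of `M` of weight less than `1`. The vertex sets of the latter are pairwise disjoint. Let `S`
be one of them and let `q < θ` be the smallest weight of its boundary edges. Either the edges inside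
`S` of weight at least `(1 - q) * θ` or the light boundary edges repair `S`. An inside edge
contributes at least `(1 - q) * θ`, a boundary edge `q / 2` as it is shared with at most one other
set, and `(1 - q) * θ + q / 2 ≥ θ` because `θ ≤ 1 / 2`. So the smaller of the two sets is paid for,
at a price of `θ` for each of its edges, by weight not used by the heavy edges.
-/

section OrbitDensity

open MulAction

variable {G Z : Type*} [Group G] [MulAction G Z]

variable (G) in
/-- The proportion of the orbit of `z` that lies in `X`, that is, the probability that a random
translate of `z` lies in `X`; it is `0` if the orbit is infinite. -/
noncomputable def orbitDensity (X : Set Z) (z : Z) : ℝ :=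
  (orbit G z ∩ X).ncard / (orbit G z).ncard

theorem orbitDensity_smul (X : Set Z) (g : G) (z : Z) :
    orbitDensity G X (g • z) = orbitDensity G X z := by
  rw [orbitDensity, orbit_smul, orbitDensity]

theorem orbitDensity_nonneg (X : Set Z) (z : Z) : 0 ≤ orbitDensity G X z := by
  unfold orbitDensity
  positivity

theorem ncard_orbit_mul_orbitDensity {z : Z} (hz : (orbit G z).Finite) (X : Set Z) :
    (orbit G z).ncard * orbitDensity G X z = (orbit G z ∩ X).ncard :=
  mul_div_cancel₀ _ (by exact_mod_cast (Set.ncard_pos hz).2 (nonempty_orbit z) |>.ne')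

theorem orbitDensity_eq_sum {X : Set Z} (hX : X.Finite) (z : Z) :
    orbitDensity G X z =
      ∑ x ∈ hX.toFinset, (orbit G x).indicator (fun _ ↦ ((orbit G x).ncard : ℝ)⁻¹) z := by
  classical
  have hterm : ∀ x, (orbit G x).indicator (fun _ ↦ ((orbit G x).ncard : ℝ)⁻¹) z =
      if x ∈ orbit G z then ((orbit G z).ncard : ℝ)⁻¹ else 0 := fun x ↦ by
    rw [Set.indicator_apply, mem_orbit_symm]
    split_ifs with hx
    · rw [orbit_eq_iff.2 hx]
    · rfl
  rw [Finset.sum_congr rfl fun x _ ↦ hterm x, ← Finset.sum_filter, Finset.sum_const, nsmul_eq_mul,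
    ← div_eq_mul_inv, orbitDensity, ← Set.ncard_coe_finset]
  congr 3
  ext x
  simp [and_comm]

theorem finite_support_orbitDensity {X : Set Z} (hX : X.Finite) :
    (Function.support (orbitDensity G X)).Finite := by
  refine (hX.biUnion (t := fun x ↦ {z ∈ orbit G x | (orbit G x).Finite}) fun x _ ↦ ?_).subset
    fun z hz ↦ ?_
  · by_cases hx : (orbit G x).Finite
    · exact hx.subset fun z hz ↦ hz.1
    · simp [hx]
  · rw [Function.mem_support, orbitDensity_eq_sum hX] at hz
    obtain ⟨x, hx, hzx⟩ := Finset.exists_ne_zero_of_sum_ne_zero hz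
    rw [Set.indicator_apply_ne_zero] at hzx
    refine Set.mem_biUnion (hX.mem_toFinset.1 hx) ⟨hzx.1, Set.finite_of_ncard_ne_zero fun h0 ↦ ?_⟩
    simp [h0] at hzx

theorem sum_orbitDensity_le_ncard {X : Set Z} (hX : X.Finite) (P : Finset Z) :
    ∑ z ∈ P, orbitDensity G X z ≤ X.ncard := by
  classical
  simp_rw [orbitDensity_eq_sum hX]
  rw [Finset.sum_comm, Set.ncard_eq_toFinset_card X hX, ← nsmul_one]
  refine Finset.sum_le_card_nsmul _ _ _ fun x _ ↦ ?_
  rw [Finset.sum_indicator_eq_sum_filter, Finset.sum_const, nsmul_eq_mul, ← div_eq_mul_inv]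
  obtain hx | hx := (orbit G x).finite_or_infinite
  · refine div_le_one_of_le₀ ?_ (Nat.cast_nonneg _)
    rw [← Set.ncard_coe_finset]
    exact_mod_cast Set.ncard_le_ncard (fun z hz ↦ (Finset.mem_filter.1 hz).2) hx
  · simp [hx.ncard]

theorem ncard_orbit_inter_preimage {Y : Type*} [MulAction G Y] (f : Y →[G] Z) {y : Y}
    (hy : (orbit G y).Finite) {T : Set Z} (hT : T ⊆ orbit G (f y)) :
    (orbit G y ∩ f ⁻¹' T).ncard = T.ncard * (orbit G y ∩ f ⁻¹' {f y}).ncard := by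
  classical
  have hTfin : T.Finite := (hy.image f).subset <| hT.trans <| by
    rintro _ ⟨g, rfl⟩
    exact ⟨g • y, mem_orbit y g, map_smul f g y⟩
  have hfiber : ∀ x ∈ T, (orbit G y ∩ f ⁻¹' {x}).ncard = (orbit G y ∩ f ⁻¹' {f y}).ncard := by
    intro x hx
    obtain ⟨g, rfl⟩ := hT hx
    rw [← Set.ncard_image_of_injective (orbit G y ∩ f ⁻¹' {f y}) (MulAction.injective g)]
    congr 1
    ext a
    constructor
    · rintro ⟨ha, hfa⟩
      refine ⟨g⁻¹ • a, ⟨mem_orbit_of_mem_orbit _ ha, ?_⟩, smul_inv_smul g a⟩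
      exact (map_smul f g⁻¹ a).trans (inv_smul_eq_iff.2 hfa)
    · rintro ⟨b, ⟨hb, hfb⟩, rfl⟩
      exact ⟨mem_orbit_of_mem_orbit _ hb, (map_smul f g b).trans (congrArg (g • ·) hfb)⟩
  rw [Set.ncard_eq_toFinset_card _ (hy.inter_of_left _), Set.ncard_eq_toFinset_card _ hTfin]
  refine (Finset.card_eq_sum_card_fiberwise (f := f) (t := hTfin.toFinset) ?_).trans
    (Finset.sum_const_nat fun x hx ↦ ?_)
  · exact fun a ha ↦ by simpa using (Set.Finite.mem_toFinset _ |>.1 ha).2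
  · rw [Set.Finite.mem_toFinset] at hx
    rw [← hfiber x hx, ← Set.ncard_coe_finset]
    congr 1
    ext a
    simp only [Finset.coe_filter, Set.Finite.mem_toFinset, Set.mem_inter_iff, Set.mem_preimage,
      Set.mem_ofPred_eq, Set.mem_singleton_iff, and_assoc]
    exact and_congr_right fun _ ↦ ⟨And.right, fun h ↦ ⟨h ▸ hx, h⟩⟩

theorem orbitDensity_preimage {Y : Type*} [MulAction G Y] (f : Y →[G] Z) {y : Y}
    (hy : (orbit G y).Finite) (X : Set Z) :
    orbitDensity G (f ⁻¹' X) y = orbitDensity G X (f y) := by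
  have hmaps : orbit G y ⊆ f ⁻¹' orbit G (f y) := by
    rintro _ ⟨g, rfl⟩
    exact ⟨g, (map_smul f g y).symm⟩
  have hnum := ncard_orbit_inter_preimage f hy (T := orbit G (f y) ∩ X) Set.inter_subset_left
  have hden := ncard_orbit_inter_preimage f hy subset_rfl
  rw [Set.preimage_inter, ← Set.inter_assoc, Set.inter_eq_left.2 hmaps] at hnum
  rw [Set.inter_eq_left.2 hmaps] at hden
  have hne : ((orbit G y ∩ f ⁻¹' {f y}).ncard : ℝ) ≠ 0 := by
    have : y ∈ orbit G y ∩ f ⁻¹' {f y} := ⟨mem_orbit_self y, rfl⟩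
    exact_mod_cast ((Set.ncard_pos (hy.inter_of_left _)).2 ⟨y, this⟩).ne'
  rw [orbitDensity, orbitDensity, hnum, hden, Nat.cast_mul, Nat.cast_mul,
    mul_div_mul_right _ _ hne]

open scoped Pointwise in
/-- This is B. H. Neumann's covering lemma: the set `{g | g • p.1 = p.2}` is empty or a coset of
the stabilizer of `p.1`, and cosets of infinite index can be discarded from a finite cover. -/
theorem exists_finite_orbit_smul_eq {D : Set (Z × Z)} (hD : D.Finite)
    (hcover : ∀ g : G, ∃ p ∈ D, g • p.1 = p.2) (g : G) :
    ∃ p ∈ D, (orbit G p.1).Finite ∧ g • p.1 = p.2 := by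
  classical
  let transporter : Z × Z → G := fun p ↦ if h : ∃ g : G, g • p.1 = p.2 then h.choose else 1
  have mem_coset {p : Z × Z} (h : ∃ g : G, g • p.1 = p.2) (k : G) :
      k ∈ transporter p • (stabilizer G p.1 : Set G) ↔ k • p.1 = p.2 := by
    have hp : transporter p • p.1 = p.2 := by
      simpa only [transporter, dif_pos h] using h.choose_spec
    rw [mem_leftCoset_iff, SetLike.mem_coe, mem_stabilizer_iff, mul_smul, inv_smul_eq_iff, hp]
  let s := hD.toFinset.filter fun p ↦ ∃ g : G, g • p.1 = p.2
  have hs {p : Z × Z} : p ∈ s ↔ p ∈ D ∧ ∃ g : G, g • p.1 = p.2 := by simp [s]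
  have hfull : ⋃ p ∈ s, transporter p • (stabilizer G p.1 : Set G) = Set.univ :=
    Set.eq_univ_of_forall fun k ↦ by
      obtain ⟨p, hp, hk⟩ := hcover k
      exact Set.mem_biUnion (hs.2 ⟨hp, k, hk⟩) ((mem_coset ⟨k, hk⟩ k).2 hk)
  have hfinite := Subgroup.leftCoset_cover_filter_FiniteIndex hfull
  obtain ⟨p, hp, hg⟩ := Set.mem_iUnion₂.1 (hfinite ▸ Set.mem_univ g)
  obtain ⟨hps, hindex⟩ := Finset.mem_filter.1 hp
  refine ⟨p, (hs.1 hps).1, Set.finite_of_ncard_ne_zero ?_, (mem_coset (hs.1 hps).2 g).1 hg⟩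
  exact index_stabilizer G p.1 ▸ hindex.index_ne_zero

variable {ι : Type*} {X : Set Z} {z : ι → Z} {n : ℕ}

theorem le_ncard_finite_orbit_smul_mem [Finite ι] (hX : X.Finite)
    (h : ∀ g : G, n ≤ {i | g • z i ∈ X}.ncard) (g : G) :
    n ≤ {i | (orbit G (z i)).Finite ∧ g • z i ∈ X}.ncard := by
  by_contra! hlt
  let D := {p ∈ Set.range z ×ˢ X | ¬((orbit G p.1).Finite ∧ g • p.1 ∈ X)}
  have hD : D.Finite := ((Set.finite_range z).prod hX).subset (Set.sep_subset _ _)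
  have hcover : ∀ k : G, ∃ p ∈ D, k • p.1 = p.2 := fun k ↦ by
    obtain ⟨i, hk, hi⟩ := Set.exists_mem_notMem_of_ncard_lt_ncard (hlt.trans_le (h k))
    exact ⟨(z i, k • z i), ⟨⟨⟨i, rfl⟩, hk⟩, hi⟩, rfl⟩
  obtain ⟨p, ⟨⟨-, hpX⟩, hp⟩, hfin, hgp⟩ := exists_finite_orbit_smul_eq hD hcover g
  exact hp ⟨hfin, hgp ▸ hpX⟩

variable [Fintype ι]

theorem le_sum_orbitDensity_of_finite_orbit (hz : ∀ i, (orbit G (z i)).Finite)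
    (h : ∀ g : G, n ≤ {i | g • z i ∈ X}.ncard) : (n : ℝ) ≤ ∑ i, orbitDensity G X (z i) := by
  classical
  have hfin : (orbit G z).Finite := (Set.Finite.pi fun i ↦ hz i).subset <| by
    rintro _ ⟨g, rfl⟩ i -
    exact mem_orbit (z i) g
  have hcount : hfin.toFinset.card • n ≤ ∑ i, (orbit G z ∩ Function.eval i ⁻¹' X).ncard :=
    calc hfin.toFinset.card • n
      _ ≤ ∑ p ∈ hfin.toFinset, {i | p i ∈ X}.ncard := by
        refine Finset.card_nsmul_le_sum _ _ _ fun p hp ↦ ?_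
        obtain ⟨g, rfl⟩ := hfin.mem_toFinset.1 hp
        exact h g
      _ = ∑ p ∈ hfin.toFinset, ∑ i, if p i ∈ X then 1 else 0 := by
        simp [Set.ncard_eq_toFinset_card']
      _ = ∑ i, (orbit G z ∩ Function.eval i ⁻¹' X).ncard := by
        rw [Finset.sum_comm]
        refine Finset.sum_congr rfl fun i _ ↦ ?_
        rw [← Finset.card_filter, ← Set.ncard_coe_finset]
        congr 1
        ext p
        simp
  have hpos : (0 : ℝ) < (orbit G z).ncard := by
    exact_mod_cast (Set.ncard_pos hfin).2 (nonempty_orbit z)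
  refine le_of_mul_le_mul_left ?_ hpos
  rw [Finset.mul_sum]
  have hdensity : ∀ i, (orbit G z).ncard * orbitDensity G X (z i) =
      (orbit G z ∩ Function.eval i ⁻¹' X).ncard := fun i ↦ by
    have heval := orbitDensity_preimage (Pi.evalMulActionHom i : (ι → Z) →[G] Z) hfin X
    rw [← ncard_orbit_mul_orbitDensity hfin]
    exact congrArg _ heval.symm
  rw [Finset.sum_congr rfl fun i _ ↦ hdensity i]
  rw [smul_eq_mul, ← Set.ncard_eq_toFinset_card _ hfin] at hcount
  exact_mod_cast hcount

theorem le_sum_orbitDensity (hX : X.Finite) (h : ∀ g : G, n ≤ {i | g • z i ∈ X}.ncard) :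
    (n : ℝ) ≤ ∑ i, orbitDensity G X (z i) := by
  classical
  let J := {i // (orbit G (z i)).Finite}
  have hJ : ∀ g : G, n ≤ {j : J | g • z j ∈ X}.ncard := fun g ↦ by
    rw [← Set.ncard_image_of_injective _ Subtype.val_injective]
    convert le_ncard_finite_orbit_smul_mem hX h g
    ext i
    simp [J, and_comm]
  calc (n : ℝ) ≤ ∑ j : J, orbitDensity G X (z j) :=
        le_sum_orbitDensity_of_finite_orbit (fun j ↦ j.2) hJ
    _ ≤ ∑ i, orbitDensity G X (z i) := by
        rw [← Fintype.sum_subtype_add_sum_subtype (fun i ↦ (orbit G (z i)).Finite)]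
        exact le_add_of_nonneg_right (Finset.sum_nonneg fun i _ ↦ orbitDensity_nonneg X _)

end OrbitDensity

section Cuts

open SimpleGraph

variable {V V' : Type*} {Γ : SimpleGraph V} {Γ' : SimpleGraph V'}

/-- The edges with both ends in `S`. -/
def insideEdges (Γ : SimpleGraph V) (S : Set V) : Set (Sym2 V) :=
  Γ.edgeSet ∩ S.sym2

/-- The cut defined by `S`: the edges with exactly one end in `S`. -/
def boundaryEdges (Γ : SimpleGraph V) (S : Set V) : Set (Sym2 V) :=
  Γ.edgeSet \ (S.sym2 ∪ Sᶜ.sym2)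

theorem mk_mem_boundaryEdges {S : Set V} {u v : V} :
    s(u, v) ∈ boundaryEdges Γ S ↔ Γ.Adj u v ∧ (u ∈ S ↔ v ∉ S) := by
  simp only [boundaryEdges, Set.mem_sdiff, mem_edgeSet, Set.mem_union, Set.mk_mem_sym2_iff,
    Set.mem_compl_iff]
  tauto

theorem mem_boundaryEdges {S : Set V} {a : Sym2 V} :
    a ∈ boundaryEdges Γ S ↔ ∃ u v, Γ.Adj u v ∧ u ∈ S ∧ v ∉ S ∧ a = s(u, v) := by
  induction a with | _ p q
  rw [mk_mem_boundaryEdges]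
  constructor
  · rintro ⟨hpq, h⟩
    by_cases hp : p ∈ S
    · exact ⟨p, q, hpq, hp, h.1 hp, rfl⟩
    · exact ⟨q, p, hpq.symm, not_not.1 (mt h.2 hp), hp, Sym2.eq_swap⟩
  · rintro ⟨u, v, huv, hu, hv, h⟩
    obtain ⟨rfl, rfl⟩ | ⟨rfl, rfl⟩ := Sym2.eq_iff.1 h
    · exact ⟨huv, iff_of_true hu hv⟩
    · exact ⟨huv.symm, iff_of_false hv (not_not.2 hu)⟩

theorem boundaryEdges_compl (S : Set V) : boundaryEdges Γ Sᶜ = boundaryEdges Γ S := by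
  rw [boundaryEdges, compl_compl, Set.union_comm, boundaryEdges]

theorem map_image_edgeSet (g : Γ ≃g Γ') : Sym2.map g '' Γ.edgeSet = Γ'.edgeSet := by
  refine Set.Subset.antisymm (Hom.image_edgeSet_subset g.toHom) fun a ha ↦ ?_
  induction a with | _ u v
  exact ⟨s(g.symm u, g.symm v), g.symm.map_adj_iff.2 ha, by simp⟩

theorem insideEdges_image (g : Γ ≃g Γ') (S : Set V) :
    insideEdges Γ' (g '' S) = Sym2.map g '' insideEdges Γ S := by
  rw [insideEdges, insideEdges, Set.image_inter (Sym2.map.injective g.injective),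
    map_image_edgeSet, Set.sym2_image]

theorem boundaryEdges_image (g : Γ ≃g Γ') (S : Set V) :
    boundaryEdges Γ' (g '' S) = Sym2.map g '' boundaryEdges Γ S := by
  rw [boundaryEdges, boundaryEdges, Set.image_sdiff (Sym2.map.injective g.injective),
    map_image_edgeSet, Set.image_union, ← Set.sym2_image, ← Set.sym2_image,
    Set.image_compl_eq g.bijective]

theorem boundaryEdges_deleteEdges (S : Set V) (s : Set (Sym2 V)) :
    boundaryEdges (Γ.deleteEdges s) S = boundaryEdges Γ S \ s := by
  rw [boundaryEdges, edgeSet_deleteEdges, sdiff_right_comm, boundaryEdges]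

theorem nonempty_boundaryEdges_of_reachable {S : Set V} {u v : V} (h : Γ.Reachable u v)
    (hu : u ∈ S) (hv : v ∉ S) : (boundaryEdges Γ S).Nonempty := by
  obtain ⟨p⟩ := h
  obtain ⟨d, -, hfst, hsnd⟩ := p.exists_boundary_dart S hu hv
  exact ⟨d.edge, mk_mem_boundaryEdges.2 ⟨d.adj, iff_of_true hfst hsnd⟩⟩

theorem boundaryEdges_reachable (u : V) : boundaryEdges Γ {w | Γ.Reachable u w} = ∅ := by
  refine Set.eq_empty_of_forall_notMem fun a ↦ ?_
  induction a with | _ v w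
  rw [mk_mem_boundaryEdges]
  rintro ⟨hvw, h⟩
  have : Γ.Reachable u v ↔ Γ.Reachable u w :=
    ⟨fun h ↦ h.trans hvw.reachable, fun h ↦ h.trans hvw.symm.reachable⟩
  exact iff_not_self (this.symm.trans h)

theorem isEdgeConnected_two_iff_nontrivial_boundaryEdges :
    Γ.IsEdgeConnected 2 ↔
      ∀ S : Set V, S.Nonempty → Sᶜ.Nonempty → (boundaryEdges Γ S).Nontrivial := by
  rw [isEdgeConnected_two]
  constructor
  · rintro h S ⟨u, hu⟩ ⟨v, hv⟩
    have hcut (e : Sym2 V) : (boundaryEdges Γ S \ {e}).Nonempty := by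
      rw [← boundaryEdges_deleteEdges]
      exact nonempty_boundaryEdges_of_reachable (h e u v) hu hv
    obtain ⟨a, ha, -⟩ := hcut s(u, u)
    obtain ⟨b, hb, hba⟩ := hcut a
    exact ⟨b, hb, a, ha, hba⟩
  · intro h e u v
    by_contra huv
    obtain ⟨a, ha, hae⟩ :=
      (h {w | (Γ.deleteEdges {e}).Reachable u w} ⟨u, .rfl⟩ ⟨v, huv⟩).exists_ne e
    have hempty := boundaryEdges_reachable (Γ := Γ.deleteEdges {e}) u
    rw [boundaryEdges_deleteEdges] at hempty
    exact hempty.subset ⟨ha, hae⟩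

theorem boundaryEdges_inter_subset (S T : Set V) :
    boundaryEdges Γ (S ∩ T) ⊆ boundaryEdges Γ S ∪ boundaryEdges Γ T := by
  intro a
  induction a with | _ u v
  simp only [Set.mem_union, mk_mem_boundaryEdges, Set.mem_inter_iff]
  tauto

/-- Take `A` minimal with a single boundary edge `s(u, v)`, where `u ∈ A`, and an automorphism
moving `u` to another neighbour `x` of `u`. The side of the translated cut that avoids `u` meets
`A` in a smaller set with a single boundary edge. -/
theorem boundaryEdges_ne_singleton [Finite V] (htrans : Γ.IsVertexTransitive)
    (hnbr : ∀ v, (Γ.neighborSet v).Nontrivial) (A : Set V) (e : Sym2 V) :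
    boundaryEdges Γ A ≠ {e} := by
  induction A using WellFoundedLT.induction generalizing e with | _ A ih
  intro hA
  obtain ⟨u, v, -, hu, hv, rfl⟩ := mem_boundaryEdges.1 (hA.superset rfl)
  have eq_of_mem {p q : V} (h : s(p, q) ∈ boundaryEdges Γ A) : s(p, q) = s(u, v) := hA.subset h
  obtain ⟨x, hux : Γ.Adj u x, hxv⟩ := (hnbr u).exists_ne v
  have hxA : x ∈ A := by
    by_contra hxA
    have := eq_of_mem (mk_mem_boundaryEdges.2 ⟨hux, iff_of_true hu hxA⟩)
    exact hxv (Sym2.congr_right.1 this)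
  obtain ⟨ψ, hψ⟩ := htrans u x
  obtain ⟨C, huC, hC⟩ : ∃ C, u ∉ C ∧ boundaryEdges Γ C = {s(x, ψ v)} := by
    have himage : boundaryEdges Γ (ψ '' A) = {s(x, ψ v)} := by
      rw [boundaryEdges_image, hA, Set.image_singleton, Sym2.map_mk, hψ]
    by_cases huψ : u ∈ ψ '' A
    · exact ⟨(ψ '' A)ᶜ, not_not.2 huψ, boundaryEdges_compl (ψ '' A) ▸ himage⟩
    · exact ⟨ψ '' A, huψ, himage⟩
  obtain ⟨hxψv, hxC⟩ := mk_mem_boundaryEdges.1 (hC.superset rfl)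
  have hψvA : ψ v ∈ A := by
    by_contra hψvA
    have := eq_of_mem (mk_mem_boundaryEdges.2 ⟨hxψv, iff_of_true hxA hψvA⟩)
    obtain h | h := Sym2.eq_iff.1 this
    · exact hux.ne' h.1
    · exact hxv h.1
  refine ih (A ∩ C) ⟨Set.inter_subset_left, fun h ↦ huC (h hu).2⟩ s(x, ψ v)
    (Set.Subset.antisymm (fun a ha ↦ ?_) (Set.singleton_subset_iff.2 ?_))
  · obtain haA | haC := boundaryEdges_inter_subset A C ha
    · obtain rfl : a = s(u, v) := hA.subset haA
      simp [mk_mem_boundaryEdges, huC, hv] at ha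
    · exact hC.subset haC
  · simpa [mk_mem_boundaryEdges, hxψv, hxA, hψvA] using hxC

theorem isEdgeConnected_two_of_isVertexTransitive [Finite V] (hconn : Γ.Connected)
    (htrans : Γ.IsVertexTransitive) (hnbr : ∀ v, (Γ.neighborSet v).Nontrivial) :
    Γ.IsEdgeConnected 2 := by
  refine isEdgeConnected_two_iff_nontrivial_boundaryEdges.2 fun A ⟨u, hu⟩ ⟨v, hv⟩ ↦ ?_
  obtain ⟨e, he⟩ := nonempty_boundaryEdges_of_reachable (hconn.preconnected u v) hu hv
  exact (Set.nontrivial_iff_ne_singleton he).2 (boundaryEdges_ne_singleton htrans hnbr A e)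

end Cuts

section Copies

open SimpleGraph

variable {U V : Type*} {M : SimpleGraph U} {Γ : SimpleGraph V} {X : Set (Sym2 V)}

/-- The action on unordered pairs induced by an action on points. -/
instance sym2MulAction {G α : Type*} [Monoid G] [MulAction G α] : MulAction G (Sym2 α) where
  smul g := Sym2.map (g • ·)
  one_smul a := by
    induction a
    exact congrArg₂ Sym2.mk (one_smul G _) (one_smul G _)
  mul_smul g h a := by
    induction a
    exact congrArg₂ Sym2.mk (mul_smul g h _) (mul_smul g h _)

theorem range_toCopy_comp (g : Γ ≃g Γ) (φ : Copy M Γ) :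
    Set.range (g.toCopy.comp φ) = g '' Set.range φ := by
  rw [Copy.coe_comp, Set.range_comp]
  rfl

theorem map_toCopy_comp (g : Γ ≃g Γ) (φ : Copy M Γ) (b : Sym2 U) :
    Sym2.map (g.toCopy.comp φ) b = Sym2.map g (Sym2.map φ b) := by
  rw [Sym2.map_map]
  rfl

theorem map_mem_insideEdges (φ : Copy M Γ) {b : Sym2 U} (hb : b ∈ M.edgeSet) :
    Sym2.map φ b ∈ insideEdges Γ (Set.range φ) := by
  refine ⟨φ.toHom.map_mem_edgeSet hb, ?_⟩
  induction b
  exact ⟨Set.mem_range_self _, Set.mem_range_self _⟩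

theorem range_sdiff_range_nonempty [Finite U] {φ ψ : Copy M Γ} (h : Set.range φ ≠ Set.range ψ) :
    (Set.range φ \ Set.range ψ).Nonempty := by
  rw [Set.sdiff_nonempty]
  refine fun hsub ↦ h (Set.eq_of_subset_of_ncard_le hsub (le_of_eq ?_) (Set.finite_range ψ))
  exact (Nat.card_range_of_injective ψ.injective).trans
    (Nat.card_range_of_injective φ.injective).symm

theorem nontrivial_setOf_map_mem_boundaryEdges (hM : M.IsEdgeConnected 2) (φ : Copy M Γ)
    {S : Set V} (hin : (Set.range φ ∩ S).Nonempty) (hout : (Set.range φ \ S).Nonempty) :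
    {b : M.edgeSet | Sym2.map φ b ∈ boundaryEdges Γ S}.Nontrivial := by
  obtain ⟨_, ⟨x, rfl⟩, hx⟩ := hin
  obtain ⟨_, ⟨y, rfl⟩, hy⟩ := hout
  have hcut := isEdgeConnected_two_iff_nontrivial_boundaryEdges.1 hM (φ ⁻¹' S) ⟨x, hx⟩ ⟨y, hy⟩
  have map_mem {b : Sym2 U} (hb : b ∈ boundaryEdges M (φ ⁻¹' S)) :
      Sym2.map φ b ∈ boundaryEdges Γ S := by
    induction b
    rw [mk_mem_boundaryEdges] at hb
    exact mk_mem_boundaryEdges.2 ⟨φ.toHom.map_adj hb.1, hb.2⟩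
  obtain ⟨b, hb, c, hc, hbc⟩ := hcut
  exact ⟨⟨b, hb.1⟩, map_mem hb, ⟨c, hc.1⟩, map_mem hc, by simpa using hbc⟩

/-- Every edge leaving a copy of `M` in `Γ` is in `X` unless an edge of the copy is. If `M` is
vertex-transitive, these are the sets meeting all copies of `M` with a pendant edge attached. -/
def IsBoundaryRepresentative (M : SimpleGraph U) (Γ : SimpleGraph V) (X : Set (Sym2 V)) : Prop :=
  ∀ φ : Copy M Γ, (∀ b ∈ M.edgeSet, Sym2.map φ b ∉ X) → boundaryEdges Γ (Set.range φ) ⊆ X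

theorem IsBoundaryRepresentative.image_boundaryEdges_subset
    (hX : IsBoundaryRepresentative M Γ X) {φ : Copy M Γ} {g : Γ ≃g Γ}
    (h : ∀ b : M.edgeSet, g • Sym2.map φ b ∉ X) :
    ∀ a ∈ boundaryEdges Γ (Set.range φ), g • a ∈ X := by
  intro a ha
  refine hX (g.toCopy.comp φ) (fun b hb ↦ map_toCopy_comp g φ b ▸ h ⟨b, hb⟩) ?_
  rw [range_toCopy_comp, boundaryEdges_image]
  exact ⟨a, ha, rfl⟩

theorem IsBoundaryRepresentative.one_le_sum_orbitDensity [Fintype M.edgeSet]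
    (hX : IsBoundaryRepresentative M Γ X) (hfin : X.Finite) (φ : Copy M Γ) {a : Sym2 V}
    (ha : a ∈ boundaryEdges Γ (Set.range φ)) :
    1 ≤ ∑ b : M.edgeSet, orbitDensity (Γ ≃g Γ) X (Sym2.map φ b) + orbitDensity (Γ ≃g Γ) X a := by
  have hhit (g : Γ ≃g Γ) :
      1 ≤ {i : Option M.edgeSet | g • i.elim a (Sym2.map φ ·) ∈ X}.ncard := by
    rw [Nat.one_le_iff_ne_zero, ← Nat.pos_iff_ne_zero, Set.ncard_pos]
    by_cases h : ∃ b : M.edgeSet, g • Sym2.map φ b ∈ X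
    · obtain ⟨b, hb⟩ := h
      exact ⟨some b, hb⟩
    · exact ⟨none, hX.image_boundaryEdges_subset (not_exists.1 h) a ha⟩
  have := le_sum_orbitDensity hfin hhit
  rwa [Fintype.sum_option, add_comm, Nat.cast_one] at this

theorem IsBoundaryRepresentative.two_le_ncard_of_forall_notMem [Finite U]
    (hM : M.IsEdgeConnected 2) (hX : IsBoundaryRepresentative M Γ X) {φ ψ : Copy M Γ}
    (hne : Set.range φ ≠ Set.range ψ) (hdisj : ¬Disjoint (Set.range φ) (Set.range ψ))
    {g : Γ ≃g Γ} (h : ∀ b : M.edgeSet, g • Sym2.map φ b ∉ X) :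
    2 ≤ {b : M.edgeSet | g • Sym2.map ψ b ∈ X}.ncard := by
  have hcross := nontrivial_setOf_map_mem_boundaryEdges hM ψ
    (Set.not_disjoint_iff_nonempty_inter.1 fun hd ↦ hdisj hd.symm)
    (range_sdiff_range_nonempty hne.symm)
  exact (Set.one_lt_ncard_iff_nontrivial).2 <|
    hcross.mono fun b hb ↦ hX.image_boundaryEdges_subset h _ hb

theorem IsBoundaryRepresentative.two_le_sum_orbitDensity [Finite U] [Fintype M.edgeSet]
    (hM : M.IsEdgeConnected 2) (hX : IsBoundaryRepresentative M Γ X) (hfin : X.Finite)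
    {φ ψ : Copy M Γ} (hne : Set.range φ ≠ Set.range ψ)
    (hdisj : ¬Disjoint (Set.range φ) (Set.range ψ)) :
    2 ≤ ∑ b : M.edgeSet, orbitDensity (Γ ≃g Γ) X (Sym2.map φ b) +
      ∑ b : M.edgeSet, orbitDensity (Γ ≃g Γ) X (Sym2.map ψ b) := by
  let z : M.edgeSet ⊕ M.edgeSet → Sym2 V := Sum.elim (Sym2.map φ ·) (Sym2.map ψ ·)
  have hhit (g : Γ ≃g Γ) : 2 ≤ {i | g • z i ∈ X}.ncard := by
    let hits (χ : Copy M Γ) : Set M.edgeSet := {b | g • Sym2.map χ b ∈ X}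
    have hsplit : {i | g • z i ∈ X} = Sum.inl '' hits φ ∪ Sum.inr '' hits ψ := by
      ext (b | b) <;> simp [z, hits]
    rw [hsplit, Set.ncard_union_eq Set.disjoint_image_inl_image_inr,
      Set.ncard_image_of_injective _ Sum.inl_injective,
      Set.ncard_image_of_injective _ Sum.inr_injective]
    obtain hφ | hφ := (hits φ).eq_empty_or_nonempty
    · exact (hX.two_le_ncard_of_forall_notMem hM hne hdisj
        (Set.eq_empty_iff_forall_notMem.1 hφ)).trans (Nat.le_add_left _ _)
    obtain hψ | hψ := (hits ψ).eq_empty_or_nonempty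
    · exact (hX.two_le_ncard_of_forall_notMem hM hne.symm (fun h ↦ hdisj h.symm)
        (Set.eq_empty_iff_forall_notMem.1 hψ)).trans (Nat.le_add_right _ _)
    · exact Nat.add_le_add ((Set.ncard_pos (hits φ).toFinite).2 hφ)
        ((Set.ncard_pos (hits ψ).toFinite).2 hψ)
  have := le_sum_orbitDensity hfin hhit
  rwa [Fintype.sum_sum_type] at this

end Copies

section Rounding

open SimpleGraph

variable {U V : Type*} {M : SimpleGraph U} {Γ : SimpleGraph V} {X : Set (Sym2 V)}
  {w : Sym2 V → ℝ} {θ : ℝ} {S : Set V}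

/-- An automorphism-invariant edge weighting satisfying the two inequalities that
`IsBoundaryRepresentative` imposes on the orbit densities; to be rounded to an invariant set. -/
structure IsFractionalRepresentative (M : SimpleGraph U) [Fintype M.edgeSet] (Γ : SimpleGraph V)
    (w : Sym2 V → ℝ) : Prop where
  nonneg : ∀ a, 0 ≤ w a
  finite_support : (Function.support w).Finite
  map_eq : ∀ (g : Γ ≃g Γ) a, w (Sym2.map g a) = w a
  one_le : ∀ φ : Copy M Γ, ∀ a ∈ boundaryEdges Γ (Set.range φ),
    1 ≤ ∑ b : M.edgeSet, w (Sym2.map φ b) + w a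
  two_le : ∀ φ ψ : Copy M Γ, Set.range φ ≠ Set.range ψ → ¬Disjoint (Set.range φ) (Set.range ψ) →
    2 ≤ ∑ b : M.edgeSet, w (Sym2.map φ b) + ∑ b : M.edgeSet, w (Sym2.map ψ b)

theorem IsBoundaryRepresentative.isFractionalRepresentative [Finite U] [Fintype M.edgeSet]
    (hX : IsBoundaryRepresentative M Γ X) (hM : M.IsEdgeConnected 2) (hfin : X.Finite) :
    IsFractionalRepresentative M Γ (orbitDensity (Γ ≃g Γ) X) where
  nonneg := orbitDensity_nonneg X
  finite_support := finite_support_orbitDensity hfin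
  map_eq := orbitDensity_smul X
  one_le φ _ ha := hX.one_le_sum_orbitDensity hfin φ ha
  two_le _ _ hne hdisj := hX.two_le_sum_orbitDensity hM hfin hne hdisj

/-- The edges of weight at least the threshold `θ`. -/
def heavyEdges (Γ : SimpleGraph V) (w : Sym2 V → ℝ) (θ : ℝ) : Set (Sym2 V) :=
  Γ.edgeSet ∩ w ⁻¹' Set.Ici θ

/-- The infimum of the weights of the edges leaving `S`; it is `0` if there are none. -/
noncomputable def minBoundaryWeight (Γ : SimpleGraph V) (w : Sym2 V → ℝ) (S : Set V) : ℝ :=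
  sInf (w '' boundaryEdges Γ S)

/-- The edges leaving `S` that are not heavy. -/
def lightBoundary (Γ : SimpleGraph V) (w : Sym2 V → ℝ) (θ : ℝ) (S : Set V) : Set (Sym2 V) :=
  boundaryEdges Γ S ∩ w ⁻¹' Set.Iio θ

/-- The edges inside `S` that are not heavy, but whose weight is close enough to the threshold that
each copy of `M` on `S` has such an edge or a heavy one. -/
def lightInside (Γ : SimpleGraph V) (w : Sym2 V → ℝ) (θ : ℝ) (S : Set V) : Set (Sym2 V) :=
  insideEdges Γ S ∩ w ⁻¹' Set.Ico ((1 - minBoundaryWeight Γ w S) * θ) θ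

/-- The vertex sets of the copies of `M` at which the heavy edges fail to be a boundary
representative. -/
def deficientSets (M : SimpleGraph U) (Γ : SimpleGraph V) (w : Sym2 V → ℝ) (θ : ℝ) :
    Set (Set V) :=
  {S | (∃ φ : Copy M Γ, Set.range φ = S ∧ ∀ b ∈ M.edgeSet, Sym2.map φ b ∉ heavyEdges Γ w θ) ∧
    (lightBoundary Γ w θ S).Nonempty}

/-- The smaller of the two sets of light edges that repair a deficient set `S`; both are finite in
that case, so that `ncard` is their true size. -/
noncomputable def cheaperSide (Γ : SimpleGraph V) (w : Sym2 V → ℝ) (θ : ℝ) (S : Set V) :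
    Set (Sym2 V) :=
  if (lightInside Γ w θ S).ncard ≤ (lightBoundary Γ w θ S).ncard then lightInside Γ w θ S
  else lightBoundary Γ w θ S

/-- The set of edges obtained by rounding the weighting `w`: the heavy edges, together with the
repairs of the deficient sets. -/
noncomputable def roundedSet (M : SimpleGraph U) (Γ : SimpleGraph V) (w : Sym2 V → ℝ) (θ : ℝ) :
    Set (Sym2 V) :=
  heavyEdges Γ w θ ∪ ⋃ S ∈ deficientSets M Γ w θ, cheaperSide Γ w θ S

theorem cheaperSide_subset : cheaperSide Γ w θ S ⊆ Γ.edgeSet := by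
  unfold cheaperSide
  split_ifs
  · exact Set.inter_subset_left.trans Set.inter_subset_left
  · exact Set.inter_subset_left.trans Set.sdiff_subset

theorem roundedSet_subset_edgeSet : roundedSet M Γ w θ ⊆ Γ.edgeSet :=
  Set.union_subset Set.inter_subset_left (Set.iUnion₂_subset fun _ _ ↦ cheaperSide_subset)

theorem ncard_cheaperSide : (cheaperSide Γ w θ S).ncard =
    min (lightInside Γ w θ S).ncard (lightBoundary Γ w θ S).ncard := by
  unfold cheaperSide
  rw [min_def, apply_ite Set.ncard]

section Invariance

variable {g : Γ ≃g Γ} (hg : ∀ a, w (Sym2.map g a) = w a)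
include hg

theorem image_inter_preimage_of_map_eq (s : Set (Sym2 V)) (T : Set ℝ) :
    Sym2.map g '' (s ∩ w ⁻¹' T) = Sym2.map g '' s ∩ w ⁻¹' T := by
  have hpreimage : w ⁻¹' T = Sym2.map g ⁻¹' (w ⁻¹' T) := Set.ext fun a ↦ by
    rw [Set.mem_preimage, Set.mem_preimage, Set.mem_preimage, hg]
  rw [hpreimage, Set.image_inter_preimage, ← hpreimage]

theorem image_heavyEdges : Sym2.map g '' heavyEdges Γ w θ = heavyEdges Γ w θ := by
  rw [heavyEdges, image_inter_preimage_of_map_eq hg, map_image_edgeSet]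

theorem minBoundaryWeight_image (S : Set V) :
    minBoundaryWeight Γ w (g '' S) = minBoundaryWeight Γ w S := by
  simp only [minBoundaryWeight, boundaryEdges_image, Set.image_image, hg]

theorem lightBoundary_image (S : Set V) :
    lightBoundary Γ w θ (g '' S) = Sym2.map g '' lightBoundary Γ w θ S := by
  rw [lightBoundary, lightBoundary, image_inter_preimage_of_map_eq hg, boundaryEdges_image]

theorem lightInside_image (S : Set V) :
    lightInside Γ w θ (g '' S) = Sym2.map g '' lightInside Γ w θ S := by
  rw [lightInside, lightInside, image_inter_preimage_of_map_eq hg, insideEdges_image,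
    minBoundaryWeight_image hg]

theorem cheaperSide_image (S : Set V) :
    cheaperSide Γ w θ (g '' S) = Sym2.map g '' cheaperSide Γ w θ S := by
  have hinj := Sym2.map.injective g.injective
  rw [cheaperSide, cheaperSide, lightInside_image hg, lightBoundary_image hg,
    Set.ncard_image_of_injective _ hinj, Set.ncard_image_of_injective _ hinj,
    apply_ite (Sym2.map g '' ·)]

theorem image_mem_deficientSets (hS : S ∈ deficientSets M Γ w θ) :
    g '' S ∈ deficientSets M Γ w θ := by
  obtain ⟨⟨φ, rfl, hφ⟩, hne⟩ := hS
  refine ⟨⟨g.toCopy.comp φ, range_toCopy_comp g φ, fun b hb h ↦ hφ b hb ?_⟩, ?_⟩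
  · rw [map_toCopy_comp, ← image_heavyEdges hg] at h
    exact (Sym2.map.injective g.injective).mem_set_image.1 h
  · rw [lightBoundary_image hg]
    exact hne.image _

theorem image_roundedSet_subset : Sym2.map g '' roundedSet M Γ w θ ⊆ roundedSet M Γ w θ := by
  rw [roundedSet, Set.image_union, image_heavyEdges hg, Set.image_iUnion₂]
  refine Set.union_subset_union_right _ (Set.iUnion₂_subset fun S hS ↦ ?_)
  rw [← cheaperSide_image hg]
  exact Set.subset_biUnion_of_mem (u := cheaperSide Γ w θ) (image_mem_deficientSets hg hS)

end Invariance

theorem ncard_mul_le_sum_indicator {α : Type*} {A : Set α} {P : Finset α} {f : α → ℝ} {c : ℝ}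
    (hA : A ⊆ P) (h : ∀ a ∈ A, c ≤ f a) : A.ncard * c ≤ ∑ a ∈ P, A.indicator f a := by
  classical
  obtain ⟨s, rfl⟩ := (P.finite_toSet.subset hA).exists_finset_coe
  rw [Finset.sum_indicator_subset f (Finset.coe_subset.1 hA), Set.ncard_coe_finset, ← nsmul_eq_mul]
  exact s.card_nsmul_le_sum f c h

theorem sum_indicator_insideEdges_add_half_boundaryEdges_le {D : Finset (Set V)}
    (hD : (D : Set (Set V)).PairwiseDisjoint id) {f : Sym2 V → ℝ} (hf : ∀ a, 0 ≤ f a)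
    (a : Sym2 V) :
    ∑ S ∈ D, ((insideEdges Γ S).indicator f a + (boundaryEdges Γ S).indicator f a / 2) ≤ f a := by
  induction a with | _ p q
  have sum_mem_le (v : V) : ∑ S ∈ D, S.indicator (1 : V → ℝ) v ≤ 1 := by
    rw [← Finset.indicator_biUnion_apply D (fun S ↦ S) hD]
    exact Set.indicator_le_self' (fun _ _ ↦ zero_le_one) v
  have hterm (S : Set V) :
      (insideEdges Γ S).indicator f s(p, q) + (boundaryEdges Γ S).indicator f s(p, q) / 2 ≤
        (S.indicator 1 p + S.indicator 1 q) / 2 * f s(p, q) := by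
    have := hf s(p, q)
    by_cases hp : p ∈ S <;> by_cases hq : q ∈ S <;> by_cases hpq : Γ.Adj p q <;>
      simp [insideEdges, mk_mem_boundaryEdges, hp, hq, hpq] <;> linarith
  calc _ ≤ ∑ S ∈ D, (S.indicator 1 p + S.indicator 1 q) / 2 * f s(p, q) :=
        Finset.sum_le_sum fun S _ ↦ hterm S
    _ = (∑ S ∈ D, S.indicator 1 p + ∑ S ∈ D, S.indicator 1 q) / 2 * f s(p, q) := by
        rw [← Finset.sum_mul, ← Finset.sum_div, Finset.sum_add_distrib]
    _ ≤ f s(p, q) := by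
        refine mul_le_of_le_one_left (hf _) ?_
        linarith [sum_mem_le p, sum_mem_le q]

theorem nonempty_of_card_mul_eq_one {ι : Type*} [Fintype ι] {c : ℝ}
    (h : Fintype.card ι * c = 1) : Nonempty ι := by
  by_contra hι
  rw [not_nonempty_iff, ← Fintype.card_eq_zero_iff] at hι
  simp [hι] at h

theorem sum_lt_one_of_notMem_heavyEdges [Fintype M.edgeSet]
    (hθ : Fintype.card M.edgeSet * θ = 1) {φ : Copy M Γ}
    (hφ : ∀ b ∈ M.edgeSet, Sym2.map φ b ∉ heavyEdges Γ w θ) :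
    ∑ b : M.edgeSet, w (Sym2.map φ b) < 1 := by
  have := nonempty_of_card_mul_eq_one hθ
  calc ∑ b : M.edgeSet, w (Sym2.map φ b)
    _ < ∑ _b : M.edgeSet, θ := Finset.sum_lt_sum_of_nonempty Finset.univ_nonempty fun b _ ↦
        not_le.1 fun h ↦ hφ b b.2 ⟨φ.toHom.map_mem_edgeSet b.2, h⟩
    _ = 1 := by rw [Finset.sum_const, nsmul_eq_mul, Finset.card_univ, hθ]

namespace IsFractionalRepresentative

variable [Fintype M.edgeSet] (hw : IsFractionalRepresentative M Γ w)
include hw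

theorem isAutInvariant_roundedSet : IsAutInvariant Γ (roundedSet M Γ w θ) := by
  refine fun g ↦ (image_roundedSet_subset (hw.map_eq g)).antisymm fun a ha ↦ ?_
  refine ⟨Sym2.map g.symm a, image_roundedSet_subset (hw.map_eq g.symm) ⟨a, ha, rfl⟩, ?_⟩
  exact smul_inv_smul g a

theorem minBoundaryWeight_le {a : Sym2 V} (ha : a ∈ boundaryEdges Γ S) :
    minBoundaryWeight Γ w S ≤ w a :=
  csInf_le ⟨0, Set.forall_mem_image.2 fun b _ ↦ hw.nonneg b⟩ ⟨a, ha, rfl⟩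

theorem one_sub_minBoundaryWeight_le_sum (φ : Copy M Γ)
    (hne : (boundaryEdges Γ (Set.range φ)).Nonempty) :
    1 - minBoundaryWeight Γ w (Set.range φ) ≤ ∑ b : M.edgeSet, w (Sym2.map φ b) := by
  rw [sub_le_comm]
  refine le_csInf (hne.image w) (Set.forall_mem_image.2 fun a ha ↦ ?_)
  exact sub_le_iff_le_add'.2 (hw.one_le φ a ha)

variable (hθ : Fintype.card M.edgeSet * θ = 1)
include hθ

theorem exists_mem_edgeSet_mul_le (φ : Copy M Γ) (hne : (boundaryEdges Γ (Set.range φ)).Nonempty) :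
    ∃ b ∈ M.edgeSet, (1 - minBoundaryWeight Γ w (Set.range φ)) * θ ≤ w (Sym2.map φ b) := by
  have := nonempty_of_card_mul_eq_one hθ
  have hsum : ∑ _b : M.edgeSet, (1 - minBoundaryWeight Γ w (Set.range φ)) * θ ≤
      ∑ b : M.edgeSet, w (Sym2.map φ b) := by
    rw [Finset.sum_const, nsmul_eq_mul, mul_left_comm, Finset.card_univ, hθ, mul_one]
    exact hw.one_sub_minBoundaryWeight_le_sum φ hne
  obtain ⟨b, -, hb⟩ := Finset.exists_le_of_sum_le Finset.univ_nonempty hsum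
  exact ⟨b, b.2, hb⟩

theorem isBoundaryRepresentative_roundedSet :
    IsBoundaryRepresentative M Γ (roundedSet M Γ w θ) := by
  intro φ hφ a ha
  obtain hheavy | hlight := le_or_gt θ (w a)
  · exact Or.inl ⟨ha.1, hheavy⟩
  have unheavy : ∀ b ∈ M.edgeSet, Sym2.map φ b ∉ heavyEdges Γ w θ :=
    fun b hb h ↦ hφ b hb (Or.inl h)
  have hdeficient : Set.range φ ∈ deficientSets M Γ w θ := ⟨⟨φ, rfl, unheavy⟩, a, ha, hlight⟩
  have hrepair : cheaperSide Γ w θ (Set.range φ) ⊆ roundedSet M Γ w θ :=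
    Set.subset_union_of_subset_right
      (Set.subset_biUnion_of_mem (u := cheaperSide Γ w θ) hdeficient) _
  obtain ⟨b, hb, hle⟩ := hw.exists_mem_edgeSet_mul_le hθ φ ⟨a, ha⟩
  have hinside : Sym2.map φ b ∈ lightInside Γ w θ (Set.range φ) :=
    ⟨map_mem_insideEdges φ hb, hle,
      not_le.1 fun h ↦ unheavy b hb ⟨φ.toHom.map_mem_edgeSet hb, h⟩⟩
  refine hrepair ?_
  unfold cheaperSide at hrepair ⊢
  split_ifs at hrepair ⊢
  · exact absurd (hrepair hinside) (hφ b hb)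
  · exact ⟨ha, hlight⟩

theorem pairwiseDisjoint_deficientSets : (deficientSets M Γ w θ).PairwiseDisjoint id := by
  rintro _ ⟨⟨φ, rfl, hφ⟩, -⟩ _ ⟨⟨ψ, rfl, hψ⟩, -⟩ hne
  by_contra hdisj
  have := hw.two_le φ ψ hne hdisj
  linarith [sum_lt_one_of_notMem_heavyEdges hθ hφ, sum_lt_one_of_notMem_heavyEdges hθ hψ]

theorem minBoundaryWeight_pos (hS : S ∈ deficientSets M Γ w θ) : 0 < minBoundaryWeight Γ w S := by
  obtain ⟨⟨φ, rfl, hφ⟩, a, ha⟩ := hS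
  linarith [hw.one_sub_minBoundaryWeight_le_sum φ ⟨a, ha.1⟩, sum_lt_one_of_notMem_heavyEdges hθ hφ]

omit hθ in
theorem minBoundaryWeight_lt (hS : S ∈ deficientSets M Γ w θ) : minBoundaryWeight Γ w S < θ := by
  obtain ⟨-, a, ha, hlight⟩ := hS
  exact (hw.minBoundaryWeight_le ha).trans_lt hlight

theorem lightBoundary_subset_support (hS : S ∈ deficientSets M Γ w θ) :
    lightBoundary Γ w θ S ⊆ Function.support w := fun _ ha ↦
  ((hw.minBoundaryWeight_pos hθ hS).trans_le (hw.minBoundaryWeight_le ha.1)).ne'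

theorem finite_deficientSets : (deficientSets M Γ w θ).Finite := by
  let T : Set V := ⋃ a ∈ Function.support w, {v | v ∈ a}
  have hT : T.Finite := hw.finite_support.biUnion fun a _ ↦ by
    induction a with | _ p q
    exact (Set.toFinite {p, q}).subset fun v hv ↦ by simpa using hv
  have hdisj : (deficientSets M Γ w θ).PairwiseDisjoint (· ∩ T) :=
    (hw.pairwiseDisjoint_deficientSets hθ).mono fun S ↦ Set.inter_subset_left
  refine (hdisj.finite_biUnion_iff.1 ?_).2.subset fun S hS ↦ ⟨hS, ?_⟩
  · exact hT.subset (Set.iUnion₂_subset fun S _ ↦ Set.inter_subset_right)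
  · obtain ⟨a, ha⟩ := hS.2
    obtain ⟨u, v, -, hu, -, rfl⟩ := mem_boundaryEdges.1 ha.1
    exact ⟨u, hu, Set.mem_biUnion (hw.lightBoundary_subset_support hθ hS ha) (Sym2.mem_mk_left u v)⟩

variable (hθ' : θ ≤ 1 / 2)
include hθ'

theorem lightInside_subset_support (hS : S ∈ deficientSets M Γ w θ) :
    lightInside Γ w θ S ⊆ Function.support w := fun a ha ↦ by
  have hpos := hw.minBoundaryWeight_pos hθ hS
  have hlt := hw.minBoundaryWeight_lt hS
  refine (lt_of_lt_of_le (mul_pos ?_ ?_) ha.2.1).ne' <;> linarith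

/-- Each element of the smaller side is paid `(1 - q) * θ` by an edge of `lightInside` and `q / 2`
by an edge of `lightBoundary`, where `q` is the minimal weight of a boundary edge. -/
theorem ncard_cheaperSide_mul_le (hS : S ∈ deficientSets M Γ w θ) :
    (cheaperSide Γ w θ S).ncard * θ ≤
      ∑ a ∈ hw.finite_support.toFinset, ((lightInside Γ w θ S).indicator w a +
        (lightBoundary Γ w θ S).indicator w a / 2) := by
  have hpos := hw.minBoundaryWeight_pos hθ hS
  have hlt := hw.minBoundaryWeight_lt hS
  have hJ := ncard_mul_le_sum_indicator (c := (1 - minBoundaryWeight Γ w S) * θ) (f := w)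
    (hw.finite_support.coe_toFinset.symm ▸ hw.lightInside_subset_support hθ hθ' hS)
    fun a ha ↦ ha.2.1
  have hL := ncard_mul_le_sum_indicator (c := minBoundaryWeight Γ w S) (f := w)
    (hw.finite_support.coe_toFinset.symm ▸ hw.lightBoundary_subset_support hθ hS)
    fun a ha ↦ hw.minBoundaryWeight_le ha.1
  rw [Finset.sum_add_distrib, ← Finset.sum_div]
  set q := minBoundaryWeight Γ w S
  set m := (cheaperSide Γ w θ S).ncard with hm
  have hmJ : (m : ℝ) ≤ (lightInside Γ w θ S).ncard := by
    exact_mod_cast hm.trans_le (ncard_cheaperSide.trans_le (min_le_left _ _))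
  have hmL : (m : ℝ) ≤ (lightBoundary Γ w θ S).ncard := by
    exact_mod_cast hm.trans_le (ncard_cheaperSide.trans_le (min_le_right _ _))
  calc (m : ℝ) * θ
    _ ≤ m * ((1 - q) * θ) + m * q / 2 := by
      have : 0 ≤ m * q * (1 / 2 - θ) := by have := sub_nonneg.2 hθ'; positivity
      linarith
    _ ≤ (lightInside Γ w θ S).ncard * ((1 - q) * θ) +
        (lightBoundary Γ w θ S).ncard * q / 2 := by
      have : 0 ≤ (1 - q) * θ := mul_nonneg (by linarith) (by linarith)
      gcongr
    _ ≤ _ := by gcongr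

omit hθ' in
theorem indicator_add_sum_indicator_le (a : Sym2 V) :
    (heavyEdges Γ w θ).indicator w a + ∑ S ∈ (hw.finite_deficientSets hθ).toFinset,
      ((lightInside Γ w θ S).indicator w a + (lightBoundary Γ w θ S).indicator w a / 2) ≤ w a := by
  let f := (w ⁻¹' Set.Iio θ).indicator w
  have hf : ∀ a, 0 ≤ f a := Set.indicator_nonneg fun a _ ↦ hw.nonneg a
  have hdisj : ((hw.finite_deficientSets hθ).toFinset : Set (Set V)).PairwiseDisjoint id := by
    rw [Set.Finite.coe_toFinset]
    exact hw.pairwiseDisjoint_deficientSets hθ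
  have hterm (S : Set V) :
      (lightInside Γ w θ S).indicator w a + (lightBoundary Γ w θ S).indicator w a / 2 ≤
        (insideEdges Γ S).indicator f a + (boundaryEdges Γ S).indicator f a / 2 := by
    rw [Set.indicator_indicator, Set.indicator_indicator]
    refine add_le_add_left (Set.indicator_le_indicator_of_subset ?_ hw.nonneg a) _
    exact Set.inter_subset_inter_right _ (Set.preimage_mono Set.Ico_subset_Iio_self)
  have hheavy : (heavyEdges Γ w θ).indicator w a ≤ (w ⁻¹' Set.Iio θ)ᶜ.indicator w a :=
    Set.indicator_le_indicator_of_subset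
      (Set.inter_subset_right.trans fun b (hb : θ ≤ w b) ↦ not_lt.2 hb) hw.nonneg a
  calc _ ≤ (w ⁻¹' Set.Iio θ)ᶜ.indicator w a + f a := add_le_add hheavy <|
        (Finset.sum_le_sum fun S _ ↦ hterm S).trans
          (sum_indicator_insideEdges_add_half_boundaryEdges_le hdisj hf a)
    _ = w a := Set.indicator_compl_add_self_apply _ w a

theorem roundedSet_subset_support : roundedSet M Γ w θ ⊆ Function.support w := by
  refine Set.union_subset (fun a ha h0 ↦ ?_) (Set.iUnion₂_subset fun S hS ↦ ?_)
  · have : 0 < θ := pos_of_mul_pos_right (hθ.symm ▸ one_pos) (Nat.cast_nonneg _)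
    exact (this.trans_le ha.2).ne' h0
  · unfold cheaperSide
    split_ifs
    · exact hw.lightInside_subset_support hθ hθ' hS
    · exact hw.lightBoundary_subset_support hθ hS

theorem ncard_roundedSet_mul_le :
    (roundedSet M Γ w θ).ncard * θ ≤ ∑ a ∈ hw.finite_support.toFinset, w a := by
  set D := (hw.finite_deficientSets hθ).toFinset with hD
  set P := hw.finite_support.toFinset with hP
  have hθ0 : 0 < θ := pos_of_mul_pos_right (hθ.symm ▸ one_pos) (Nat.cast_nonneg _)
  have hheavy : (heavyEdges Γ w θ).ncard * θ ≤ ∑ a ∈ P, (heavyEdges Γ w θ).indicator w a := by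
    refine ncard_mul_le_sum_indicator ?_ fun a ha ↦ ha.2
    rw [hP, Set.Finite.coe_toFinset]
    exact Set.subset_union_left.trans (hw.roundedSet_subset_support hθ hθ')
  have hcard : (roundedSet M Γ w θ).ncard ≤
      (heavyEdges Γ w θ).ncard + ∑ S ∈ D, (cheaperSide Γ w θ S).ncard := by
    refine (Set.ncard_union_le _ _).trans (Nat.add_le_add_left ?_ _)
    simpa [hD] using D.set_ncard_biUnion_le (cheaperSide Γ w θ)
  calc (roundedSet M Γ w θ).ncard * θ
    _ ≤ ((heavyEdges Γ w θ).ncard + ∑ S ∈ D, ((cheaperSide Γ w θ S).ncard : ℝ)) * θ := by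
      gcongr
      exact_mod_cast hcard
    _ = (heavyEdges Γ w θ).ncard * θ + ∑ S ∈ D, (cheaperSide Γ w θ S).ncard * θ := by
      rw [add_mul, Finset.sum_mul]
    _ ≤ ∑ a ∈ P, (heavyEdges Γ w θ).indicator w a + ∑ S ∈ D, ∑ a ∈ P,
          ((lightInside Γ w θ S).indicator w a + (lightBoundary Γ w θ S).indicator w a / 2) :=
      add_le_add hheavy <| Finset.sum_le_sum fun S hS ↦
        hw.ncard_cheaperSide_mul_le hθ hθ' ((Set.Finite.mem_toFinset _).1 hS)
    _ ≤ ∑ a ∈ P, w a := by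
      rw [Finset.sum_comm, ← Finset.sum_add_distrib]
      exact Finset.sum_le_sum fun a _ ↦ hw.indicator_add_sum_indicator_le hθ a

end IsFractionalRepresentative

theorem IsBoundaryRepresentative.exists_isAutInvariant_encard_le [Finite U] [Fintype M.edgeSet]
    (hX : IsBoundaryRepresentative M Γ X) (hM : M.IsEdgeConnected 2) (hfin : X.Finite)
    (hcard : 2 ≤ Fintype.card M.edgeSet) :
    ∃ Y ⊆ Γ.edgeSet, IsBoundaryRepresentative M Γ Y ∧ IsAutInvariant Γ Y ∧
      Y.encard ≤ Fintype.card M.edgeSet * X.encard := by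
  have hw := hX.isFractionalRepresentative hM hfin
  set n := Fintype.card M.edgeSet
  have hn : (2 : ℝ) ≤ n := by exact_mod_cast hcard
  have hθ : (n : ℝ) * (n : ℝ)⁻¹ = 1 := mul_inv_cancel₀ (by positivity)
  have hθ' : (n : ℝ)⁻¹ ≤ 1 / 2 := by rw [one_div]; gcongr
  let Y := roundedSet M Γ (orbitDensity (Γ ≃g Γ) X) (n : ℝ)⁻¹
  refine ⟨Y, roundedSet_subset_edgeSet, hw.isBoundaryRepresentative_roundedSet hθ,
    hw.isAutInvariant_roundedSet, ?_⟩
  have hY : Y.Finite := hw.finite_support.subset (hw.roundedSet_subset_support hθ hθ')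
  have hle : (Y.ncard : ℝ) * (n : ℝ)⁻¹ ≤ X.ncard :=
    (hw.ncard_roundedSet_mul_le hθ hθ').trans (sum_orbitDensity_le_ncard hfin _)
  rw [← div_eq_mul_inv, div_le_iff₀' (by positivity)] at hle
  rw [← hY.cast_ncard_eq, ← hfin.cast_ncard_eq]
  exact_mod_cast hle

end Rounding

section PendantVertex

open SimpleGraph

variable {V W : Type*} {K : SimpleGraph W} {Γ : SimpleGraph V} {X : Set (Sym2 V)} {t r : W}

theorem isEdgeRepresentative_iff_forall_copy :
    IsEdgeRepresentative K Γ X ↔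
      X ⊆ Γ.edgeSet ∧ ∀ χ : Copy K Γ, ∃ b ∈ K.edgeSet, Sym2.map χ b ∈ X := by
  refine and_congr_right fun _ ↦ ⟨fun h χ ↦ ?_, fun h H ⟨ι⟩ ↦ ?_⟩
  · obtain ⟨e, he, heX⟩ := h χ.toSubgraph ⟨χ.isoToSubgraph⟩
    rw [Subgraph.edgeSet_map, Subgraph.edgeSet_top] at he
    obtain ⟨b, hb, rfl⟩ := he
    exact ⟨b, hb, heX⟩
  · obtain ⟨b, hb, hbX⟩ := h (H.coeCopy.comp ι.toCopy)
    refine ⟨_, ?_, hbX⟩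
    induction b
    exact ι.map_adj_iff.2 hb

theorem nontrivial_neighborSet_of_degree_ne_one [Nontrivial W] (hconn : K.Connected) {v : W}
    [Fintype (K.neighborSet v)] (hv : K.degree v ≠ 1) : (K.neighborSet v).Nontrivial := by
  have hpos := hconn.preconnected.degree_pos_of_nontrivial v
  rw [← Set.nontrivial_coe_sort, ← Fintype.one_lt_card_iff_nontrivial, card_neighborSet_eq_degree]
  omega

theorem nontrivial_neighborSet_of_isVertexTransitive (htrans : K.IsVertexTransitive) {x : W}
    (hx : (K.neighborSet x).Nontrivial) (y : W) : (K.neighborSet y).Nontrivial := by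
  obtain ⟨ψ, rfl⟩ := htrans x y
  refine (hx.image ψ.injective).mono ?_
  rintro _ ⟨z, hz, rfl⟩
  exact ψ.map_adj_iff.2 hz

theorem two_le_card_edgeSet [Fintype K.edgeSet] {x : W} (hx : (K.neighborSet x).Nontrivial) :
    2 ≤ Fintype.card K.edgeSet := by
  obtain ⟨y, hy, z, hz, hyz⟩ := hx
  refine Fintype.one_lt_card_iff.2 ⟨⟨s(x, y), hy⟩, ⟨s(x, z), hz⟩, fun h ↦ hyz ?_⟩
  exact Sym2.congr_right.1 (congrArg Subtype.val h)

theorem exists_nontrivial_neighborSet_induce [Fintype W] [DecidableRel K.Adj] (hconn : K.Connected)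
    (huniq : ∀ w, K.degree w = 1 → w = t) (htr : ∀ w, K.Adj t w ↔ w = r) :
    ∃ x, ((K.induce {w | w ≠ t}).neighborSet x).Nontrivial := by
  have hr : K.Adj t r := (htr r).2 rfl
  have : Nontrivial W := ⟨t, r, hr.ne⟩
  have hnbr (w : W) (hw : w ≠ t) : (K.neighborSet w).Nontrivial :=
    nontrivial_neighborSet_of_degree_ne_one hconn (mt (huniq w) hw)
  obtain ⟨w, hrw : K.Adj r w, hwt⟩ := (hnbr r hr.ne').exists_ne t
  have ne_t {y : W} (hy : K.Adj w y) : y ≠ t := by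
    rintro rfl
    exact hrw.ne ((htr w).1 hy.symm).symm
  obtain ⟨y, hy, z, hz, hyz⟩ := hnbr w hwt
  exact ⟨⟨w, hwt⟩, ⟨y, ne_t hy⟩, hy, ⟨z, ne_t hz⟩, hz, by simpa using hyz⟩

theorem eq_mk_or_exists_map_val_eq (htr : ∀ w, K.Adj t w ↔ w = r) {e : Sym2 W}
    (he : e ∈ K.edgeSet) :
    e = s(r, t) ∨ ∃ b ∈ (K.induce {w | w ≠ t}).edgeSet, Sym2.map Subtype.val b = e := by
  induction e with | _ x y
  by_cases hx : x = t
  · subst hx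
    exact Or.inl ((htr y).1 he ▸ Sym2.eq_swap)
  by_cases hy : y = t
  · subst hy
    exact Or.inl ((htr x).1 he.symm ▸ rfl)
  · exact Or.inr ⟨s(⟨x, hx⟩, ⟨y, hy⟩), he, rfl⟩

theorem exists_copy_extending (htr : ∀ w, K.Adj t w ↔ w = r) (hrt : r ≠ t)
    (φ : Copy (K.induce {w | w ≠ t}) Γ) {z : V} (hz : Γ.Adj (φ ⟨r, hrt⟩) z)
    (hzφ : z ∉ Set.range φ) :
    ∃ χ : Copy K Γ, χ t = z ∧ ∀ w : {w | w ≠ t}, χ w = φ w := by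
  classical
  let f : W → V := fun w ↦ if hw : w ≠ t then φ ⟨w, hw⟩ else z
  have hft : f t = z := by simp [f]
  have hf (w : {w | w ≠ t}) : f w = φ w := dif_pos w.2
  have hmap : ∀ e ∈ K.edgeSet, Sym2.map f e ∈ Γ.edgeSet := by
    intro e he
    obtain rfl | ⟨b, hb, rfl⟩ := eq_mk_or_exists_map_val_eq htr he
    · rwa [Sym2.map_mk, hft, hf ⟨r, hrt⟩]
    · rw [Sym2.map_map, show f ∘ Subtype.val = φ from funext hf]
      exact φ.toHom.map_mem_edgeSet hb
  have hinj : Function.Injective f := by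
    intro a b hab
    by_cases ha : a = t <;> by_cases hb : b = t
    · rw [ha, hb]
    · rw [ha, hft, hf ⟨b, hb⟩] at hab
      exact absurd ⟨_, hab.symm⟩ hzφ
    · rw [hb, hft, hf ⟨a, ha⟩] at hab
      exact absurd ⟨_, hab⟩ hzφ
    · rw [hf ⟨a, ha⟩, hf ⟨b, hb⟩] at hab
      exact congrArg Subtype.val (φ.injective hab)
  exact ⟨⟨⟨f, fun {a b} hab ↦ hmap s(a, b) hab⟩, hinj⟩, hft, hf⟩

theorem isBoundaryRepresentative_induce (htr : ∀ w, K.Adj t w ↔ w = r)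
    (htrans : (K.induce {w | w ≠ t}).IsVertexTransitive) (hX : IsEdgeRepresentative K Γ X) :
    IsBoundaryRepresentative (K.induce {w | w ≠ t}) Γ X := by
  intro φ hφ a ha
  obtain ⟨_, z, hadj, ⟨x, rfl⟩, hz, rfl⟩ := mem_boundaryEdges.1 ha
  have hrt : r ≠ t := ((htr r).2 rfl).ne'
  obtain ⟨ψ, rfl⟩ := htrans ⟨r, hrt⟩ x
  obtain ⟨χ, hχt, hχ⟩ := exists_copy_extending htr hrt (φ.comp ψ.toCopy) hadj
    fun ⟨y, hy⟩ ↦ hz ⟨ψ y, hy⟩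
  obtain ⟨e, he, heX⟩ := (isEdgeRepresentative_iff_forall_copy.1 hX).2 χ
  obtain rfl | ⟨b, hb, rfl⟩ := eq_mk_or_exists_map_val_eq htr he
  · rwa [Sym2.map_mk, hχt, hχ ⟨r, hrt⟩] at heX
  · refine absurd ?_ (hφ _ (ψ.toHom.map_mem_edgeSet hb))
    rw [Sym2.map_map] at heX ⊢
    rwa [show χ ∘ Subtype.val = φ ∘ ψ from funext hχ] at heX

theorem isEdgeRepresentative_of_isBoundaryRepresentative (htr : K.Adj t r) (hsub : X ⊆ Γ.edgeSet)
    (hX : IsBoundaryRepresentative (K.induce {w | w ≠ t}) Γ X) : IsEdgeRepresentative K Γ X := by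
  refine isEdgeRepresentative_iff_forall_copy.2 ⟨hsub, fun χ ↦ ?_⟩
  by_contra! hχ
  let φ : Copy (K.induce {w | w ≠ t}) Γ := χ.comp (Copy.induce K {w | w ≠ t})
  have hunhit : ∀ b ∈ (K.induce {w | w ≠ t}).edgeSet, Sym2.map φ b ∉ X := fun b hb ↦ by
    have := hχ (Sym2.map Subtype.val b) ((Embedding.induce _).toHom.map_mem_edgeSet hb)
    rwa [Sym2.map_map] at this
  refine hχ s(r, t) htr.symm (hX φ hunhit (mem_boundaryEdges.2 ?_))
  refine ⟨χ r, χ t, χ.toHom.map_adj htr.symm, ⟨⟨r, htr.ne'⟩, rfl⟩, ?_, rfl⟩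
  rintro ⟨w, hw⟩
  exact w.2 (χ.injective hw)

theorem ncard_edgeSet_induce_ne [Fintype W] [DecidableRel K.Adj] (t : W) :
    (K.induce {w | w ≠ t}).edgeSet.ncard = K.edgeSet.ncard - K.degree t := by
  classical
  have h := (K.card_edgeFinset_induce_compl_singleton t).trans
    (K.card_edgeFinset_deleteIncidenceSet t)
  simp only [edgeFinset_card, Fintype.card_eq_nat_card] at h
  exact h

theorem exists_isEdgeRepresentative_encard_eq_edgeRep (htr : K.Adj t r) (Γ : SimpleGraph V) :
    ∃ X, IsEdgeRepresentative K Γ X ∧ X.encard = edgeRep K Γ := by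
  have hall : IsEdgeRepresentative K Γ Γ.edgeSet := isEdgeRepresentative_iff_forall_copy.2
    ⟨subset_rfl, fun χ ↦ ⟨s(t, r), htr, χ.toHom.map_mem_edgeSet htr⟩⟩
  exact csInf_mem (s := {n | ∃ X, IsEdgeRepresentative K Γ X ∧ X.encard = n}) ⟨_, _, hall, rfl⟩

theorem symEdgeRep_le_mul_edgeRep [Fintype W] [DecidableRel K.Adj] (hconn : K.Connected)
    (ht : K.degree t = 1) (huniq : ∀ w, K.degree w = 1 → w = t)
    (htrans : (K.induce {w | w ≠ t}).IsVertexTransitive) (Γ : SimpleGraph V) :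
    symEdgeRep K Γ ≤ ((K.edgeSet.ncard - 1 : ℕ) : ℕ∞) * edgeRep K Γ := by
  classical
  obtain ⟨r, hr, hr'⟩ := degree_eq_one_iff_existsUnique_adj.1 ht
  have htr (w : W) : K.Adj t w ↔ w = r := ⟨hr' w, fun h ↦ h ▸ hr⟩
  obtain ⟨x, hx⟩ := exists_nontrivial_neighborSet_induce hconn huniq htr
  have hM : (K.induce {w | w ≠ t}).IsEdgeConnected 2 := isEdgeConnected_two_of_isVertexTransitive
    (hconn.induce_compl_singleton_of_degree_eq_one ht) htrans
    (nontrivial_neighborSet_of_isVertexTransitive htrans hx)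
  have htwo := two_le_card_edgeSet hx
  have hcard : Fintype.card (K.induce {w | w ≠ t}).edgeSet = K.edgeSet.ncard - 1 := by
    rw [Fintype.card_eq_nat_card, ← ht]
    exact ncard_edgeSet_induce_ne t
  obtain ⟨X, hX, hXcard⟩ := exists_isEdgeRepresentative_encard_eq_edgeRep hr Γ
  rw [← hXcard, ← hcard]
  obtain hfin | hinf := X.finite_or_infinite
  · obtain ⟨Y, hYsub, hY, hYinv, hYcard⟩ := (isBoundaryRepresentative_induce htr htrans hX
      ).exists_isAutInvariant_encard_le hM hfin htwo
    calc symEdgeRep K Γ ≤ Y.encard := sInf_le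
          ⟨Y, isEdgeRepresentative_of_isBoundaryRepresentative hr hYsub hY, hYinv, rfl⟩
      _ ≤ _ := hYcard
  · rw [hinf.encard_eq, ENat.mul_top (by exact_mod_cast (two_pos.trans_le htwo).ne')]
    exact le_top

theorem not_isEdgeCostly_of_symEdgeRep_le {W : Type*} {K : SimpleGraph W}
    (h : ∀ (V : Type u) (Γ : SimpleGraph V),
      symEdgeRep K Γ ≤ ((K.edgeSet.ncard - 1 : ℕ) : ℕ∞) * edgeRep K Γ) :
    ¬ IsEdgeCostly.{u} K := by
  intro hcostly
  obtain ⟨V, Γ, n, s, hn, hs, rfl, hm⟩ := hcostly 1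
  have hle : n * K.edgeSet.ncard ≤ (K.edgeSet.ncard - 1) * n := by
    exact_mod_cast hs ▸ hn ▸ h V Γ
  have hpos : 0 < n * K.edgeSet.ncard := by exact_mod_cast hm
  rw [mul_comm] at hle
  have := Nat.le_of_mul_le_mul_right hle (Nat.pos_of_mul_pos_right hpos)
  have := Nat.pos_of_mul_pos_left hpos
  omega

end PendantVertex

theorem mainTheorem1 {W : Type v} [Fintype W] (K : SimpleGraph W) [DecidableRel K.Adj]
    (hconn : K.Connected)
    (t : W) (ht : K.degree t = 1) (huniq : ∀ w : W, K.degree w = 1 → w = t)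
    (htrans : (K.induce {w : W | w ≠ t}).IsVertexTransitive) :
    (∀ (V : Type u) (Γ : SimpleGraph V),
      SimpleGraph.symEdgeRep K Γ ≤
        ((K.edgeSet.ncard - 1 : ℕ) : ℕ∞) * SimpleGraph.edgeRep K Γ) ∧
    ¬ SimpleGraph.IsEdgeCostly.{u} K :=
by
  have hle (V : Type u) (Γ : SimpleGraph V) :
      SimpleGraph.symEdgeRep K Γ ≤
        ((K.edgeSet.ncard - 1 : ℕ) : ℕ∞) * SimpleGraph.edgeRep K Γ :=
    symEdgeRep_le_mul_edgeRep hconn ht huniq htrans Γ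
  exact ⟨hle, not_isEdgeCostly_of_symEdgeRep_le hle⟩
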